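/- Theorem 1.3. Let $\tau>0$, let $\mathsf b>0$ be the positive number with $\mathsf b^2=\tau$, and let $z\in\mathbb C$ with $|\mathrm{Im}\,z|<\pi$. Let $$\Phi_{\mathsf b}(w)=\exp\left(\int_{\mathbb R+i\epsilon}\frac{e^{-2ixw}}{4\sinh(x\mathsf b)\sinh(x\mathsf b^{-1})}\frac{dx}{x}\right),\qquad 0<\epsilon<\pi\min(\mathsf b,\mathsf b^{-1}),$$ be Faddeev's quantum dilogarithm, and let $\log\Phi_{\mathsf b}(w)$ denote the integral in the exponent. Let $\mathrm{Li}_2(w)=-\int_0^1\log(1-wt)\,\frac{dt}{t}$ be the principal branch on $\mathbb C\setminus[1,\infty)$ of the dilogarithm, i.e. the analytic continuation of $\sum_{k\ge1}w^k/k^2$, and let $$G(\xi,z)=\frac1{2\pi i}\sum_{n=1}^\infty\frac{(-1)^n}{n^2}\left(\frac1{1+e^{\xi/n-z}}+\frac1{1+e^{-\xi/n-z}}\right),\qquad(\mathcal L G)(\tau,z)=\int_0^\infty e^{-\xi/\tau}G(\xi,z)\,d\xi .$$ Then the integral defining $\log\Phi_{\mathsf b}\left(\frac{z}{2\pi\mathsf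 b}\right)$, the series $G(\xi,z)$ for every $\xi\ge0$, and the integral $(\mathcal L G)(\tau,z)$ converge absolutely, and for every such $\epsilon$ $$\log\Phi_{\mathsf b}\left(\frac{z}{2\pi\mathsf b}\right)=\frac{1}{2\pi i\tau}\,\mathrm{Li}_2(-e^z)+(\mathcal L G)(\tau,z).$$ Consequently $\Phi_{\mathsf b}\left(\frac{z}{2\pi\mathsf b}\right)=\exp\left(\frac{1}{2\pi i\tau}\mathrm{Li}_2(-e^z)+(\mathcal L G)(\tau,z)\right)$. -/

import Mathlib

open MeasureTheory

noncomputable section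

namespace QDilog

/-- The integrand `e^{-2ixw} / (4 sinh(xb) sinh(x/b) x)` of Faddeev's integral. -/
def faddeevIntegrand (b : ℝ) (w x : ℂ) : ℂ :=
  Complex.exp (-2 * Complex.I * x * w) /
    (4 * Complex.sinh (x * b) * Complex.sinh (x / b) * x)

/-- The integral of `faddeevIntegrand b w` along the line `ℝ + iε`, that is, the exponent in
Faddeev's integral formula. It is the logarithm of the quantum dilogarithm that the formula
provides. -/
def logPhi (b ε : ℝ) (w : ℂ) : ℂ :=
  ∫ t : ℝ, faddeevIntegrand b w ((t : ℂ) + ε * Complex.I)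

/-- Faddeev's quantum dilogarithm `Φ_b(w)`, given by its integral formula with the contour
`ℝ + iε`. -/
def Phi (b ε : ℝ) (w : ℂ) : ℂ := Complex.exp (logPhi b ε w)

/-- The principal branch on `ℂ ∖ [1, ∞)` of Euler's dilogarithm,
`Li₂(w) = -∫₀¹ log(1 - wt)/t dt`. It is the analytic continuation of `∑_{k ≥ 1} w^k / k²`, see
`hasSum_Li2` and `differentiableOn_Li2`. -/
def Li2 (w : ℂ) : ℂ := -∫ t in (0 : ℝ)..1, Complex.log (1 - w * t) / t

/-- The term with index `n + 1` of the series for `2πi G(ξ, z)`. -/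
def GTerm (ξ z : ℂ) (n : ℕ) : ℂ :=
  (-1) ^ (n + 1) / ((n : ℂ) + 1) ^ 2 *
    (1 / (1 + Complex.exp (ξ / ((n : ℂ) + 1) - z)) +
      1 / (1 + Complex.exp (-ξ / ((n : ℂ) + 1) - z)))

/-- `G(ξ, z) = (2πi)⁻¹ ∑_{n ≥ 1} (-1)ⁿ/n² (1/(1 + e^{ξ/n - z}) + 1/(1 + e^{-ξ/n - z}))`. -/
def G (ξ z : ℂ) : ℂ := 1 / (2 * Real.pi * Complex.I) * ∑' n : ℕ, GTerm ξ z n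

/-- The Laplace transform `(𝓛 f)(τ) = ∫₀^∞ e^{-ξ/τ} f(ξ) dξ`. -/
def laplace (f : ℝ → ℂ) (τ : ℂ) : ℂ :=
  ∫ ξ in Set.Ioi (0 : ℝ), Complex.exp (-(ξ : ℂ) / τ) * f ξ

/-- The dilogarithm is the sum of its power series in the unit disc. -/
theorem hasSum_Li2 {w : ℂ} (hw : ‖w‖ < 1) :
    HasSum (fun k : ℕ => w ^ (k + 1) / ((k : ℂ) + 1) ^ 2) (Li2 w) := by
  have key := intervalIntegral.hasSum_integral_of_dominated_convergence (μ := volume)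
    (a := 0) (b := 1) (F := fun (k : ℕ) (t : ℝ) => w ^ (k + 1) / ((k : ℂ) + 1) * (t : ℂ) ^ k)
    (f := fun t : ℝ => -(Complex.log (1 - w * t) / t))
    (fun (k : ℕ) (_ : ℝ) => ‖w‖ ^ (k + 1)) ?_ ?_ ?_ ?_ ?_
  · have h2 : ∀ k : ℕ, (∫ t in (0 : ℝ)..1, w ^ (k + 1) / ((k : ℂ) + 1) * (t : ℂ) ^ k) =
        w ^ (k + 1) / ((k : ℂ) + 1) ^ 2 := by
      intro k
      have h3 : (∫ t in (0 : ℝ)..1, (t : ℂ) ^ k) = 1 / ((k : ℂ) + 1) := by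
        have := integral_pow (a := 0) (b := 1) k
        have h4 : (∫ t in (0 : ℝ)..1, ((t ^ k : ℝ) : ℂ)) = ((1 / ((k : ℝ) + 1) : ℝ) : ℂ) := by
          rw [intervalIntegral.integral_ofReal, this]; simp
        push_cast at h4
        exact h4
      rw [intervalIntegral.integral_const_mul, h3]
      field_simp
    simp only [h2, intervalIntegral.integral_neg] at key
    exact key
  · intro k
    exact (by fun_prop : Continuous fun t : ℝ =>
      w ^ (k + 1) / ((k : ℂ) + 1) * (t : ℂ) ^ k).aestronglyMeasurable
  · intro k
    refine Filter.Eventually.of_forall fun t ht => ?_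
    rw [Set.uIoc_of_le zero_le_one] at ht
    have hk : (1 : ℝ) ≤ ‖(k : ℂ) + 1‖ := by
      have : ((k : ℂ) + 1) = ((k + 1 : ℕ) : ℂ) := by push_cast; rfl
      rw [this, Complex.norm_natCast]; push_cast; linarith [(Nat.cast_nonneg k : (0 : ℝ) ≤ k)]
    rw [norm_mul, norm_div, norm_pow, norm_pow, Complex.norm_real, Real.norm_of_nonneg ht.1.le]
    have h1 : ‖w‖ ^ (k + 1) / ‖(k : ℂ) + 1‖ ≤ ‖w‖ ^ (k + 1) :=
      div_le_self (by positivity) hk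
    have h2 : t ^ k ≤ 1 := pow_le_one₀ ht.1.le ht.2
    have h3 : 0 ≤ t ^ k := pow_nonneg ht.1.le k
    calc _ ≤ ‖w‖ ^ (k + 1) * 1 := by gcongr
      _ = _ := mul_one _
  · refine Filter.Eventually.of_forall fun t _ => ?_
    exact (summable_nat_add_iff 1).2 (summable_geometric_of_lt_one (norm_nonneg w) hw)
  · exact intervalIntegrable_const
  · refine Filter.Eventually.of_forall fun t ht => ?_
    rw [Set.uIoc_of_le zero_le_one] at ht
    have ht0 : (t : ℂ) ≠ 0 := by exact_mod_cast ht.1.ne'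
    have hwt : ‖w * t‖ < 1 := by
      rw [norm_mul, Complex.norm_real, Real.norm_of_nonneg ht.1.le]
      exact lt_of_le_of_lt (mul_le_of_le_one_right (norm_nonneg w) ht.2) hw
    have h := (hasSum_nat_add_iff' 1).2 (Complex.hasSum_taylorSeries_neg_log hwt)
    have h' := h.mul_right ((t : ℂ)⁻¹)
    have e1 : (fun k : ℕ => (w * t) ^ (k + 1) / ((k + 1 : ℕ) : ℂ) * (t : ℂ)⁻¹) =
        fun k : ℕ => w ^ (k + 1) / ((k : ℂ) + 1) * (t : ℂ) ^ k := by
      funext k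
      have hk : (k : ℂ) + 1 ≠ 0 := Nat.cast_add_one_ne_zero k
      push_cast
      field_simp
      ring
    have e2 : (-Complex.log (1 - w * t) -
        ∑ i ∈ Finset.range 1, (w * t) ^ i / (i : ℂ)) * (t : ℂ)⁻¹ =
        -(Complex.log (1 - w * t) / t) := by
      simp [div_eq_mul_inv]
    rw [e1, e2] at h'
    exact h'

/-- The dilogarithm is holomorphic on `ℂ ∖ [1, ∞)`. -/
theorem differentiableOn_Li2 :
    DifferentiableOn ℂ Li2 {w : ℂ | 1 - w ∈ Complex.slitPlane} := by
  have hslit : ∀ w : ℂ, 1 - w ∈ Complex.slitPlane → ∀ t : ℝ, t ∈ Set.Icc (0 : ℝ) 1 →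
      1 - w * t ∈ Complex.slitPlane := by
    intro w hw t ht
    simp only [Complex.mem_slitPlane_iff, Complex.sub_re, Complex.sub_im, Complex.one_re,
      Complex.one_im, Complex.mul_re, Complex.mul_im, Complex.ofReal_re, Complex.ofReal_im,
      mul_zero, sub_zero, zero_add, zero_sub] at hw ⊢
    rcases eq_or_lt_of_le ht.1 with h0 | h0
    · left; simp [← h0]
    rcases hw with hw | hw
    · left
      nlinarith [ht.2]
    · right
      have : w.im ≠ 0 := by simpa using hw
      simpa using ⟨this, h0.ne'⟩
  have hopen : IsOpen {w : ℂ | 1 - w ∈ Complex.slitPlane} :=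
    Complex.isOpen_slitPlane.preimage (by fun_prop)
  intro w₀ hw₀
  obtain ⟨r, hr, hball⟩ := Metric.nhds_basis_closedBall.mem_iff.1 (hopen.mem_nhds hw₀)
  have hcont : ContinuousOn (fun p : ℂ × ℝ => ‖(-1 : ℂ) / (1 - p.1 * p.2)‖)
      (Metric.closedBall w₀ r ×ˢ Set.Icc (0 : ℝ) 1) := by
    refine ContinuousOn.norm (ContinuousOn.div (by fun_prop) (by fun_prop) ?_)
    rintro ⟨w, t⟩ ⟨hw, ht⟩
    exact Complex.slitPlane_ne_zero (hslit w (hball hw) t ht)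
  obtain ⟨C, hC⟩ := ((isCompact_closedBall w₀ r).prod isCompact_Icc).bddAbove_image hcont
  have hmeas : ∀ w : ℂ, AEStronglyMeasurable (fun t : ℝ => Complex.log (1 - w * t) / t)
      (volume.restrict (Set.uIoc (0 : ℝ) 1)) := by
    intro w
    exact (by fun_prop : Measurable fun t : ℝ =>
      Complex.log (1 - w * t) / t).aestronglyMeasurable
  have hint : IntervalIntegrable (fun t : ℝ => Complex.log (1 - w₀ * t) / t) volume 0 1 := by
    have hd : ∀ t ∈ Set.Icc (0 : ℝ) 1,
        DifferentiableAt ℝ (fun t : ℝ => Complex.log (1 - w₀ * t)) t := by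
      intro t ht
      have h1 : HasDerivAt (fun t : ℝ => 1 - w₀ * (t : ℂ)) (-(w₀ * 1)) t :=
        ((Complex.ofRealCLM.hasDerivAt (x := t)).const_mul w₀).const_sub 1
      exact (h1.clog_real (hslit w₀ hw₀ t ht)).differentiableAt
    have hc : ContinuousOn (Function.update
        (fun t : ℝ => Complex.log (1 - w₀ * t) / t) 0
        (deriv (fun t : ℝ => Complex.log (1 - w₀ * t)) 0)) (Set.Icc 0 1) := by
      have h0 : ContinuousOn (dslope (fun t : ℝ => Complex.log (1 - w₀ * t)) 0)
          (Set.Icc 0 1) := by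
        intro t ht
        by_cases h : t = 0
        · subst h
          exact (continuousAt_dslope_same.2 (hd 0 ht)).continuousWithinAt
        · exact ((continuousAt_dslope_of_ne h).2 (hd t ht).continuousAt).continuousWithinAt
      refine h0.congr fun t ht => ?_
      by_cases h : t = 0
      · subst h; simp
      · rw [Function.update_of_ne h, dslope_of_ne _ h, slope_def_module]
        simp [div_eq_inv_mul]
    have hi : IntervalIntegrable _ volume (0 : ℝ) 1 :=
      ContinuousOn.intervalIntegrable_of_Icc zero_le_one hc
    refine hi.congr ?_
    intro t ht
    rw [Set.uIoc_of_le zero_le_one] at ht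
    exact Function.update_of_ne ht.1.ne' _ _
  have key := (intervalIntegral.hasDerivAt_integral_of_dominated_loc_of_deriv_le (μ := volume)
    (a := 0) (b := 1) (x₀ := w₀) (s := Metric.closedBall w₀ r)
    (F := fun (w : ℂ) (t : ℝ) => Complex.log (1 - w * t) / t)
    (F' := fun (w : ℂ) (t : ℝ) => -1 / (1 - w * t)) (bound := fun _ => C)
    (Metric.closedBall_mem_nhds w₀ hr) (Filter.Eventually.of_forall hmeas) hint
    (by
      exact (by fun_prop : Measurable fun t : ℝ =>
        (-1 : ℂ) / (1 - w₀ * t)).aestronglyMeasurable)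
    (by
      refine Filter.Eventually.of_forall fun t ht w hw => ?_
      rw [Set.uIoc_of_le zero_le_one] at ht
      exact hC ⟨(w, t), ⟨hw, ht.1.le, ht.2⟩, rfl⟩)
    intervalIntegrable_const
    (by
      refine Filter.Eventually.of_forall fun t ht w hw => ?_
      rw [Set.uIoc_of_le zero_le_one] at ht
      have ht0 : (t : ℂ) ≠ 0 := by exact_mod_cast ht.1.ne'
      have hs := hslit w (hball hw) t ⟨ht.1.le, ht.2⟩
      have h1 : HasDerivAt (fun w : ℂ => 1 - w * t) (-(1 * (t : ℂ))) w :=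
        ((hasDerivAt_id w).mul_const (t : ℂ)).const_sub 1
      have h2 := (h1.clog hs).div_const (t : ℂ)
      refine h2.congr_deriv ?_
      rw [one_mul, div_right_comm, neg_div, div_self ht0])).2
  exact key.neg.differentiableAt.differentiableWithinAt

end QDilog

end

/-!
With `s = x / (πb)` Faddeev's integral becomes `∫ K(s) / (2 s sinh πτs) ds` over `ℝ + iδ`, where
`K(s) = e^{-isz} / (2 sinh πs)` and `0 < δ < min(1, 1/τ)`. The factor depending on `τ` has the
partial fractions (`hasSum_inv_mul_sinh`)

  `π / (s sinh πτs) = 1 / (τs²) + ∑_{n ≥ 1} (-1)ⁿ 2τ / (n² + τ²s²)`,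

and each summand is a Fourier–Laplace transform in `s`: one has `1 / s² = -∫₀^∞ r e^{isr} dr`, and
`2τ / (n² + τ²s²)` is `n⁻² ∫₀^∞ e^{-ξ/τ} (e^{-isξ/n} + e^{isξ/n}) dξ`. The kernel itself satisfies
`∫ K(s) ds = -i / (1 + e^{-z})` (`integral_kernel_line`): on the line `ℝ + i/2` this is a Beta
integral, and Cauchy's theorem moves the line. Multiplying `K` by `e^{-isu}` replaces `z` by
`z + u`, so by Fubini (`integral_mul_inv_one_add_exp`) the summand `1 / (τs²)` gives a Fermi–Dirac integral,
which integration by parts identifies with `Li₂(-e^z)` (`integral_kernel_div_sq`), and the summand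
with index `n` gives the Laplace transform of the `n`-th term of `G` (`integral_exp_mul_GTerm`).
On the line all these integrals and the sum over `n` converge absolutely, because `|Im z| < π` and
`δ < 1/τ`.
-/

namespace QDilog

open Filter Topology

/-! ### Bounds for hyperbolic functions and exponential decay -/

lemma abs_sin_im_mul_cosh_re_le_norm_sinh (s : ℂ) :
    |Real.sin s.im| * Real.cosh s.re ≤ ‖Complex.sinh s‖ := by
  have h : (Complex.sinh s).im = Real.cosh s.re * Real.sin s.im := by
    conv_lhs => rw [← Complex.re_add_im s]
    rw [Complex.sinh_add, Complex.sinh_mul_I, Complex.cosh_mul_I, ← Complex.ofReal_sinh,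
      ← Complex.ofReal_cosh, ← Complex.ofReal_sin, ← Complex.ofReal_cos]
    simp [Complex.sin_ofReal_re]
  have := Complex.abs_im_le_norm (Complex.sinh s)
  rwa [h, abs_mul, abs_of_pos (Real.cosh_pos _), mul_comm] at this

lemma sinh_ne_zero_of_sin_im_ne_zero {s : ℂ} (h : Real.sin s.im ≠ 0) : Complex.sinh s ≠ 0 := by
  rw [← norm_pos_iff]
  exact (mul_pos (abs_pos.2 h) (Real.cosh_pos _)).trans_le
    (abs_sin_im_mul_cosh_re_le_norm_sinh s)

lemma cos_half_im_mul_le_norm_one_add_exp_neg (v : ℂ) :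
    Real.cos (v.im / 2) * (1 + Real.exp (-v.re)) ≤ ‖1 + Complex.exp (-v)‖ := by
  -- Rotating by `e^{i Im v / 2}` makes the two summands complex conjugate up to positive factors.
  have h1 : ‖Complex.exp ((v.im / 2 : ℝ) * Complex.I)‖ = 1 := Complex.norm_exp_ofReal_mul_I _
  have h2 : Complex.exp ((v.im / 2 : ℝ) * Complex.I) * (1 + Complex.exp (-v)) =
      Complex.exp ((v.im / 2 : ℝ) * Complex.I) +
        Real.exp (-v.re) * Complex.exp ((-(v.im / 2) : ℝ) * Complex.I) := by
    rw [mul_add, mul_one, ← Complex.exp_add, Complex.ofReal_exp, ← Complex.exp_add]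
    congr 2
    push_cast
    linear_combination Complex.re_add_im v
  have h3 := Complex.re_le_norm
    (Complex.exp ((v.im / 2 : ℝ) * Complex.I) * (1 + Complex.exp (-v)))
  rw [norm_mul, h1, one_mul, h2, Complex.add_re, Complex.re_ofReal_mul,
    Complex.exp_ofReal_mul_I_re, Complex.exp_ofReal_mul_I_re, Real.cos_neg] at h3
  linarith

lemma cos_half_pos {y : ℝ} (hy : |y| < Real.pi) : 0 < Real.cos (y / 2) := by
  have := abs_lt.1 hy
  exact Real.cos_pos_of_mem_Ioo ⟨by linarith, by linarith⟩

lemma one_add_exp_neg_ne_zero {v : ℂ} (hv : |v.im| < Real.pi) : 1 + Complex.exp (-v) ≠ 0 := by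
  rw [← norm_pos_iff]
  exact (mul_pos (cos_half_pos hv) (by positivity)).trans_le
    (cos_half_im_mul_le_norm_one_add_exp_neg v)

lemma norm_inv_one_add_exp_neg_le {v : ℂ} (hv : |v.im| < Real.pi) :
    ‖1 / (1 + Complex.exp (-v))‖ ≤ (Real.cos (v.im / 2))⁻¹ * (1 + Real.exp (-v.re))⁻¹ := by
  rw [norm_div, norm_one, one_div, ← mul_inv]
  exact inv_anti₀ (mul_pos (cos_half_pos hv) (by positivity))
    (cos_half_im_mul_le_norm_one_add_exp_neg v)

lemma norm_inv_one_add_exp_neg_le_inv_cos {v : ℂ} (hv : |v.im| < Real.pi) :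
    ‖1 / (1 + Complex.exp (-v))‖ ≤ (Real.cos (v.im / 2))⁻¹ := by
  refine (norm_inv_one_add_exp_neg_le hv).trans (mul_le_of_le_one_right ?_ ?_)
  · exact (inv_pos.2 (cos_half_pos hv)).le
  · exact inv_le_one_of_one_le₀ (by linarith [Real.exp_pos (-v.re)])

lemma norm_inv_one_add_exp_neg_le_exp {v : ℂ} (hv : |v.im| < Real.pi) :
    ‖1 / (1 + Complex.exp (-v))‖ ≤ (Real.cos (v.im / 2))⁻¹ * Real.exp v.re := by
  refine (norm_inv_one_add_exp_neg_le hv).trans ?_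
  have := (inv_pos.2 (cos_half_pos hv)).le
  gcongr
  rw [← neg_neg v.re, Real.exp_neg (-v.re), neg_neg]
  exact inv_anti₀ (Real.exp_pos _) (by linarith)

lemma integrable_exp_neg_mul_abs {c : ℝ} (hc : 0 < c) :
    Integrable fun t : ℝ => Real.exp (-c * |t|) := by
  rw [← integrableOn_univ, ← Set.Iic_union_Ioi (a := (0 : ℝ))]
  refine IntegrableOn.union ?_ ?_
  · refine (integrableOn_exp_mul_Iic hc 0).congr_fun (fun t ht => ?_) measurableSet_Iic
    simp only [abs_of_nonpos (Set.mem_Iic.1 ht), mul_neg, neg_mul, neg_neg]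
  · refine (integrableOn_exp_mul_Ioi (neg_neg_iff_pos.2 hc) 0).congr_fun (fun t ht => ?_)
      measurableSet_Ioi
    simp only [abs_of_pos (Set.mem_Ioi.1 ht)]

/-! ### Moving a horizontal line of integration -/

/-- Cauchy's theorem for a horizontal strip: the vertical sides of the rectangles
`[-T, T] × [p, q]` contribute `O(e^{-cT})`. -/
theorem integral_horizontal_line_eq {F : ℂ → ℂ} {p q C c : ℝ} (hc : 0 < c)
    (hd : ∀ s : ℂ, s.im ∈ Set.uIcc p q → DifferentiableAt ℂ F s)
    (hF : ∀ s : ℂ, s.im ∈ Set.uIcc p q → ‖F s‖ ≤ C * Real.exp (-c * |s.re|)) :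
    ∫ t : ℝ, F (t + p * Complex.I) = ∫ t : ℝ, F (t + q * Complex.I) := by
  have him : ∀ t y : ℝ, ((t : ℂ) + y * Complex.I).im = y := by simp
  have hre : ∀ t y : ℝ, ((t : ℂ) + y * Complex.I).re = t := by simp
  have hint : ∀ y ∈ Set.uIcc p q, Integrable fun t : ℝ => F (t + y * Complex.I) := by
    intro y hy
    refine ((integrable_exp_neg_mul_abs hc).const_mul C).mono' ?_ ?_
    · refine Continuous.aestronglyMeasurable (continuous_iff_continuousAt.2 fun t => ?_)
      exact ContinuousAt.comp (f := fun t : ℝ => (t : ℂ) + y * Complex.I)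
        (hd _ (by rwa [him])).continuousAt (by fun_prop)
    · refine Eventually.of_forall fun t => ?_
      simpa only [hre] using hF (t + y * Complex.I) (by rwa [him])
  have hlim : ∀ y ∈ Set.uIcc p q, Tendsto (fun T : ℝ => ∫ t in -T..T, F (t + y * Complex.I))
      atTop (𝓝 (∫ t : ℝ, F (t + y * Complex.I))) := fun y hy =>
    intervalIntegral_tendsto_integral (hint y hy) tendsto_neg_atTop_atBot tendsto_id
  have hvert : ∀ σ : ℝ, |σ| = 1 → Tendsto (fun T : ℝ =>
      ∫ y in p..q, F ((σ * T : ℝ) + y * Complex.I)) atTop (𝓝 0) := by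
    intro σ hσ
    have h0 : Tendsto (fun T : ℝ => C * Real.exp (-c * T) * |q - p|) atTop (𝓝 0) := by
      have h1 : Tendsto (fun T : ℝ => Real.exp (-c * T)) atTop (𝓝 0) :=
        Real.tendsto_exp_atBot.comp
          (tendsto_id.const_mul_atTop_of_neg (neg_neg_iff_pos.2 hc))
      simpa using (h1.const_mul C).mul_const |q - p|
    refine squeeze_zero_norm' ?_ h0
    filter_upwards [eventually_ge_atTop 0] with T hT
    refine intervalIntegral.norm_integral_le_of_norm_le_const fun y hy => ?_
    have := hF ((σ * T : ℝ) + y * Complex.I) (by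
      rw [him]; exact Set.uIoc_subset_uIcc hy)
    rwa [hre, abs_mul, hσ, one_mul, abs_of_nonneg hT] at this
  have hrect : ∀ T : ℝ, (∫ t in -T..T, F (t + p * Complex.I)) =
      (∫ t in -T..T, F (t + q * Complex.I)) -
        Complex.I * (∫ y in p..q, F ((1 * T : ℝ) + y * Complex.I)) +
        Complex.I * (∫ y in p..q, F (((-1) * T : ℝ) + y * Complex.I)) := by
    intro T
    have := Complex.integral_boundary_rect_eq_zero_of_differentiableOn F
      (((-T : ℝ) : ℂ) + p * Complex.I) ((T : ℂ) + q * Complex.I) (by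
        intro s hs
        rw [him, him] at hs
        exact (hd s hs.2).differentiableWithinAt)
    simp only [him, hre, smul_eq_mul] at this
    rw [one_mul, neg_one_mul]
    linear_combination this
  refine tendsto_nhds_unique (hlim p Set.left_mem_uIcc) ?_
  simp_rw [hrect]
  simpa using ((hlim q Set.right_mem_uIcc).sub ((hvert 1 (by simp)).const_mul Complex.I)).add
    ((hvert (-1) (by simp)).const_mul Complex.I)

/-! ### The Fourier transform of the hyperbolic cosecant -/

/-- The integrand `e^{-isz} / (2 sinh πs)`, the part of Faddeev's integrand, in the variable
`s = x / (πb)`, that does not depend on `b`. -/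
noncomputable def kernel (z s : ℂ) : ℂ :=
  Complex.exp (-Complex.I * s * z) / (2 * Complex.sinh (Real.pi * s))

lemma norm_exp_neg_I_mul (s z : ℂ) :
    ‖Complex.exp (-Complex.I * s * z)‖ = Real.exp (s.im * z.re + s.re * z.im) := by
  rw [Complex.norm_exp]
  congr 1
  simp
  ring

lemma sin_pi_mul_pos {y : ℝ} (h0 : 0 < y) (h1 : y < 1) : 0 < Real.sin (Real.pi * y) :=
  Real.sin_pos_of_pos_of_lt_pi (by positivity) (by nlinarith [Real.pi_pos])

lemma sinh_pi_mul_ne_zero {s : ℂ} (h0 : 0 < s.im) (h1 : s.im < 1) :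
    Complex.sinh (Real.pi * s) ≠ 0 := by
  refine sinh_ne_zero_of_sin_im_ne_zero ?_
  rw [Complex.im_ofReal_mul]
  exact (sin_pi_mul_pos h0 h1).ne'

lemma norm_kernel_le (z : ℂ) {s : ℂ} (h0 : 0 < s.im) (h1 : s.im < 1) :
    ‖kernel z s‖ ≤ Real.exp (s.im * z.re) / Real.sin (Real.pi * s.im) *
      Real.exp (-(Real.pi - |z.im|) * |s.re|) := by
  have hs := sin_pi_mul_pos h0 h1
  have hsinh : Real.sin (Real.pi * s.im) * Real.exp (Real.pi * |s.re|) ≤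
      ‖2 * Complex.sinh (Real.pi * s)‖ := by
    have := abs_sin_im_mul_cosh_re_le_norm_sinh (Real.pi * s)
    rw [Complex.im_ofReal_mul, Complex.re_ofReal_mul, abs_of_pos hs] at this
    have hcosh : Real.exp (Real.pi * |s.re|) ≤ 2 * Real.cosh (Real.pi * s.re) := by
      rw [← Real.cosh_abs, abs_mul, abs_of_pos Real.pi_pos, Real.cosh_eq]
      linarith [Real.exp_pos (-(Real.pi * |s.re|))]
    rw [norm_mul, Complex.norm_two]
    nlinarith
  rw [kernel, norm_div, norm_exp_neg_I_mul]
  have hnum : Real.exp (s.im * z.re + s.re * z.im) ≤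
      Real.exp (s.im * z.re) * Real.exp (|z.im| * |s.re|) := by
    rw [← Real.exp_add, ← abs_mul]
    refine Real.exp_le_exp.2 ?_
    linarith [le_abs_self (z.im * s.re)]
  calc _ ≤ Real.exp (s.im * z.re) * Real.exp (|z.im| * |s.re|) /
        (Real.sin (Real.pi * s.im) * Real.exp (Real.pi * |s.re|)) := by gcongr
    _ = _ := by
      rw [show -(Real.pi - |z.im|) * |s.re| = |z.im| * |s.re| - Real.pi * |s.re| by ring,
        Real.exp_sub]
      ring

lemma differentiableAt_kernel (z : ℂ) {s : ℂ} (h0 : 0 < s.im) (h1 : s.im < 1) :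
    DifferentiableAt ℂ (kernel z) s := by
  unfold kernel
  refine DifferentiableAt.div (by fun_prop) (by fun_prop) ?_
  exact mul_ne_zero two_ne_zero (sinh_pi_mul_ne_zero h0 h1)

lemma continuous_kernel_line (z : ℂ) {δ : ℝ} (h0 : 0 < δ) (h1 : δ < 1) :
    Continuous fun t : ℝ => kernel z (t + δ * Complex.I) :=
  continuous_iff_continuousAt.2 fun t =>
    ContinuousAt.comp (f := fun t : ℝ => (t : ℂ) + δ * Complex.I)
      (differentiableAt_kernel z (by simpa) (by simpa)).continuousAt (by fun_prop)

lemma integrable_kernel_line {z : ℂ} (hz : |z.im| < Real.pi) {δ : ℝ} (h0 : 0 < δ) (h1 : δ < 1) :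
    Integrable fun t : ℝ => kernel z (t + δ * Complex.I) := by
  refine ((integrable_exp_neg_mul_abs (sub_pos.2 hz)).const_mul
    (Real.exp (δ * z.re) / Real.sin (Real.pi * δ))).mono'
    (continuous_kernel_line z h0 h1).aestronglyMeasurable (Eventually.of_forall fun t => ?_)
  simpa using norm_kernel_le z (s := t + δ * Complex.I) (by simpa) (by simpa)

/-- Between the lines `ℝ + iδ` and `ℝ + iδ'` the kernel has no poles. -/
lemma integral_kernel_line_eq {z : ℂ} (hz : |z.im| < Real.pi) {δ δ' : ℝ} (h0 : 0 < δ)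
    (h1 : δ < 1) (h0' : 0 < δ') (h1' : δ' < 1) :
    ∫ t : ℝ, kernel z (t + δ * Complex.I) = ∫ t : ℝ, kernel z (t + δ' * Complex.I) := by
  have hmem : ∀ y ∈ Set.uIcc δ δ', 0 < y ∧ y < 1 := fun y hy =>
    ⟨(lt_min h0 h0').trans_le hy.1, hy.2.trans_lt (max_lt h1 h1')⟩
  have hcont : ContinuousOn (fun y : ℝ => Real.exp (y * z.re) / Real.sin (Real.pi * y))
      (Set.uIcc δ δ') :=
    ContinuousOn.div (by fun_prop) (by fun_prop) fun y hy =>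
      (sin_pi_mul_pos (hmem y hy).1 (hmem y hy).2).ne'
  obtain ⟨C, hC⟩ := isCompact_uIcc.bddAbove_image hcont
  refine integral_horizontal_line_eq (C := C) (sub_pos.2 hz)
    (fun s hs => differentiableAt_kernel z (hmem _ hs).1 (hmem _ hs).2) fun s hs => ?_
  refine (norm_kernel_le z (hmem _ hs).1 (hmem _ hs).2).trans ?_
  gcongr
  exact hC ⟨_, hs, rfl⟩

/-- Euler's Beta integral `B(u, 1 - u) = π / sin πu`, after the substitution
`x = 1 / (1 + e^{-y})`. -/
lemma integral_exp_div_one_add_exp {u : ℂ} (h0 : 0 < u.re) (h1 : u.re < 1) :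
    ∫ y : ℝ, Complex.exp (-(1 - u) * y) / (1 + Complex.exp (-y)) =
      Real.pi / Complex.sin (Real.pi * u) := by
  have hB : Complex.betaIntegral u (1 - u) = Real.pi / Complex.sin (Real.pi * u) := by
    have := Complex.Gamma_mul_Gamma_eq_betaIntegral h0 (t := 1 - u) (by simpa)
    rw [Complex.Gamma_mul_Gamma_one_sub] at this
    simpa using this.symm
  have himage : Real.sigmoid '' Set.univ = Set.Ioo 0 1 := by
    rw [Set.image_univ, Real.range_sigmoid]
  rw [← hB, Complex.betaIntegral, intervalIntegral.integral_of_le zero_le_one,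
    integral_Ioc_eq_integral_Ioo, ← himage,
    integral_image_eq_integral_abs_deriv_smul MeasurableSet.univ
      (fun x _ => (Real.hasDerivAt_sigmoid x).hasDerivWithinAt) Real.sigmoid_injective.injOn,
    Measure.restrict_univ]
  congr 1 with y
  have hσ := Real.sigmoid_pos y
  have hσ' := sub_pos.2 (Real.sigmoid_lt_one y)
  have hσ0 : (Real.sigmoid y : ℂ) ≠ 0 := by exact_mod_cast hσ.ne'
  have hσ0' : (1 - Real.sigmoid y : ℂ) ≠ 0 := by exact_mod_cast hσ'.ne'
  have hlog : Real.log (1 - Real.sigmoid y) = Real.log (Real.sigmoid y) - y := by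
    rw [← Real.sigmoid_neg, ← Real.sigmoid_mul_rexp_neg, Real.log_mul hσ.ne' (Real.exp_ne_zero _),
      Real.log_exp]
    ring
  have hinv : (1 + Complex.exp (-y))⁻¹ = Real.sigmoid y := by
    rw [Real.sigmoid_def]; push_cast; rfl
  have hpow1 : (Real.sigmoid y : ℂ) ^ (u - 1) * Real.sigmoid y =
      Complex.exp (Real.log (Real.sigmoid y) * u) := by
    rw [Complex.cpow_sub _ _ hσ0, Complex.cpow_one, div_mul_cancel₀ _ hσ0,
      Complex.cpow_def_of_ne_zero hσ0,
      Complex.ofReal_log hσ.le]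
  have hpow2 : (1 - Real.sigmoid y : ℂ) ^ (1 - u - 1) * (1 - Real.sigmoid y) =
      Complex.exp ((Real.log (Real.sigmoid y) - y) * (1 - u)) := by
    rw [Complex.cpow_sub _ _ hσ0', Complex.cpow_one, div_mul_cancel₀ _ hσ0',
      Complex.cpow_def_of_ne_zero hσ0',
      ← Complex.ofReal_sub, ← hlog, Complex.ofReal_log hσ'.le]
    push_cast
    rfl
  have hexp : (Real.sigmoid y : ℂ) = Complex.exp (Real.log (Real.sigmoid y)) := by
    rw [← Complex.ofReal_exp, Real.exp_log hσ]
  rw [abs_of_pos (mul_pos hσ hσ'), Complex.real_smul, div_eq_mul_inv, hinv]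
  push_cast
  calc _ = Complex.exp (-(1 - u) * y) * Complex.exp (Real.log (Real.sigmoid y)) := by
        rw [← hexp]
    _ = Complex.exp (Real.log (Real.sigmoid y) * u) *
        Complex.exp ((Real.log (Real.sigmoid y) - y) * (1 - u)) := by
        rw [← Complex.exp_add, ← Complex.exp_add]; congr 1; ring
    _ = _ := by rw [← hpow1, ← hpow2]; ring

/-- On the line `ℝ + i/2` the kernel is `e^{z/2} e^{-itz} / (2i cosh πt)`, whose integral is a Beta
integral. The other lines follow by Cauchy's theorem. -/
theorem integral_kernel_line {z : ℂ} (hz : |z.im| < Real.pi) {δ : ℝ} (h0 : 0 < δ) (h1 : δ < 1) :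
    ∫ t : ℝ, kernel z (t + δ * Complex.I) = -Complex.I * (1 / (1 + Complex.exp (-z))) := by
  have hpi := Real.pi_pos
  have hpiC : (Real.pi : ℂ) ≠ 0 := by exact_mod_cast hpi.ne'
  rw [integral_kernel_line_eq hz h0 h1 (δ' := 1 / 2) (by norm_num) (by norm_num)]
  set u : ℂ := 1 / 2 - Complex.I * z / (2 * Real.pi) with hu
  have hure : u.re = 1 / 2 + z.im / (2 * Real.pi) := by
    have : u = 1 / 2 - ((1 / (2 * Real.pi) : ℝ) : ℂ) * (Complex.I * z) := by
      rw [hu]; push_cast; ring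
    rw [this, Complex.sub_re, Complex.re_ofReal_mul]
    simp
    ring
  have hz' := abs_lt.1 hz
  have hlt : z.im / (2 * Real.pi) < 1 / 2 := by
    rw [div_lt_iff₀ (by positivity)]; linarith
  have hgt : -(1 / 2) < z.im / (2 * Real.pi) := by
    rw [lt_div_iff₀ (by positivity)]; linarith
  have hbeta := integral_exp_div_one_add_exp (u := u) (by linarith) (by linarith)
  have hpt : ∀ t : ℝ, kernel z (t + ((1 / 2 : ℝ) : ℂ) * Complex.I) =
      (-Complex.I * Complex.exp (z / 2)) *
        (fun y : ℝ => Complex.exp (-(1 - u) * y) / (1 + Complex.exp (-y)))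
          (2 * Real.pi * t) := by
    intro t
    have hsinh : 2 * Complex.sinh (Real.pi * (t + ((1 / 2 : ℝ) : ℂ) * Complex.I)) =
        Complex.I * (Complex.exp (Real.pi * t) * (1 + Complex.exp (-(2 * Real.pi * t)))) := by
      rw [mul_add, Complex.sinh_add, show (Real.pi : ℂ) * (((1 / 2 : ℝ) : ℂ) * Complex.I) =
        (Real.pi / 2 : ℂ) * Complex.I by push_cast; ring, Complex.cosh_mul_I, Complex.sinh_mul_I,
        Complex.cos_pi_div_two, Complex.sin_pi_div_two, Complex.cosh,
        show (-(Real.pi * t) : ℂ) = Real.pi * t + -(2 * Real.pi * t) by ring, Complex.exp_add]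
      ring
    have hne : 1 + Complex.exp (-(2 * Real.pi * t)) ≠ 0 :=
      one_add_exp_neg_ne_zero (v := 2 * Real.pi * t) (by
        rw [show (2 * Real.pi * t : ℂ) = ((2 * Real.pi * t : ℝ) : ℂ) by push_cast; rfl,
          Complex.ofReal_im, abs_zero]
        exact hpi)
    have hexp : Complex.exp (-Complex.I * (t + ((1 / 2 : ℝ) : ℂ) * Complex.I) * z) =
        Complex.exp (z / 2) * Complex.exp (-(1 - u) * (2 * Real.pi * t)) *
          Complex.exp (Real.pi * t) := by
      rw [← Complex.exp_add, ← Complex.exp_add]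
      congr 1
      rw [hu]
      push_cast
      field_simp
      linear_combination (-z) * Complex.I_sq
    rw [kernel, hsinh, hexp]
    push_cast
    have := Complex.exp_ne_zero (Real.pi * t)
    field_simp
    rw [Complex.I_sq]
    ring
  simp_rw [hpt]
  rw [integral_const_mul, Measure.integral_comp_mul_left
    (fun y : ℝ => Complex.exp (-(1 - u) * y) / (1 + Complex.exp (-y))), hbeta,
    abs_of_pos (by positivity), Complex.real_smul]
  have hsin : Complex.sin (Real.pi * u) = Complex.cosh (z / 2) := by
    rw [show Real.pi * u = Real.pi / 2 - z / 2 * Complex.I by rw [hu]; field_simp,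
      Complex.sin_pi_div_two_sub, Complex.cos_mul_I]
  have hcosh : 2 * Complex.cosh (z / 2) = Complex.exp (z / 2) * (1 + Complex.exp (-z)) := by
    rw [mul_add, ← Complex.exp_add, show z / 2 + -z = -(z / 2) by ring, Complex.cosh]
    ring
  have hne := one_add_exp_neg_ne_zero hz
  have hne' := Complex.exp_ne_zero (z / 2)
  rw [hsin]
  push_cast
  rw [show (2 * Real.pi : ℂ)⁻¹ * (Real.pi / Complex.cosh (z / 2)) =
    1 / (2 * Complex.cosh (z / 2)) by field_simp, hcosh]
  field_simp

lemma im_add_ofReal_mul_ofReal (z : ℂ) (a ξ : ℝ) : (z + a * ξ).im = z.im := by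
  rw [← Complex.ofReal_mul, Complex.add_im, Complex.ofReal_im, add_zero]

/-- Fubini's theorem for the Fourier representation of `1 / (1 + e^{-v})`: averaging
`1 / (1 + e^{-(z + aξ)})` over `ξ > 0` with weight `w` multiplies the kernel by the Fourier–Laplace
transform of `w`. -/
theorem integral_mul_inv_one_add_exp {z : ℂ} (hz : |z.im| < Real.pi) {δ : ℝ} (h0 : 0 < δ)
    (h1 : δ < 1) (a : ℝ) {w : ℝ → ℂ}
    (hw : IntegrableOn (fun ξ : ℝ => w ξ * Complex.exp ((a * δ : ℝ) * ξ)) (Set.Ioi 0)) :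
    ∫ ξ in Set.Ioi (0 : ℝ), w ξ * (1 / (1 + Complex.exp (-(z + a * ξ)))) =
      Complex.I * ∫ t : ℝ, kernel z (t + δ * Complex.I) *
        ∫ ξ in Set.Ioi (0 : ℝ), w ξ * Complex.exp (-Complex.I * (t + δ * Complex.I) * (a * ξ)) := by
  have hker : ∀ ξ : ℝ, w ξ * (1 / (1 + Complex.exp (-(z + a * ξ)))) =
      Complex.I * ∫ t : ℝ, kernel z (t + δ * Complex.I) *
        (w ξ * Complex.exp (-Complex.I * (t + δ * Complex.I) * (a * ξ))) := by
    intro ξ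
    have h := integral_kernel_line (z := z + a * ξ)
      (by rwa [im_add_ofReal_mul_ofReal]) h0 h1
    have h' : ∀ t : ℝ, kernel z (t + δ * Complex.I) *
        (w ξ * Complex.exp (-Complex.I * (t + δ * Complex.I) * (a * ξ))) =
        w ξ * kernel (z + a * ξ) (t + δ * Complex.I) := by
      intro t
      simp only [kernel]
      rw [mul_add (-Complex.I * (t + δ * Complex.I)), Complex.exp_add]
      ring
    simp_rw [h']
    rw [integral_const_mul, h]
    linear_combination (w ξ * (1 / (1 + Complex.exp (-(z + a * ξ))))) * Complex.I_sq
  simp_rw [hker]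
  rw [integral_const_mul]
  congr 1
  rw [integral_integral_swap]
  · simp_rw [integral_const_mul]
  · -- Up to a unimodular factor the integrand is a product of functions of `ξ` and of `t`.
    have hprod := hw.mul_prod (integrable_kernel_line hz h0 h1)
    have hcont : Continuous fun p : ℝ × ℝ => Complex.exp ((-(p.2 * (a * p.1)) : ℝ) * Complex.I) :=
      by fun_prop
    refine (hprod.bdd_mul (c := 1) hcont.aestronglyMeasurable
      (Eventually.of_forall fun p => (Complex.norm_exp_ofReal_mul_I _).le)).congr
      (Eventually.of_forall fun p => ?_)
    simp only [Function.uncurry]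
    have : Complex.exp (-Complex.I * (p.2 + δ * Complex.I) * (a * p.1)) =
        Complex.exp ((-(p.2 * (a * p.1)) : ℝ) * Complex.I) *
          Complex.exp ((a * δ : ℝ) * p.1) := by
      rw [← Complex.exp_add]
      congr 1
      push_cast
      linear_combination (-(δ * (a * p.1)) : ℂ) * Complex.I_sq
    rw [this]
    ring

/-! ### The dilogarithm as an integral of the kernel -/

lemma integrableOn_mul_exp_neg {c : ℝ} (hc : 0 < c) :
    IntegrableOn (fun r : ℝ => r * Real.exp (-c * r)) (Set.Ioi 0) := by
  have := integrableOn_rpow_mul_exp_neg_mul_rpow (s := 1) (p := 1) (b := c) (by norm_num) one_pos hc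
  simpa using this

lemma tendsto_mul_exp_neg {c : ℝ} (hc : 0 < c) :
    Tendsto (fun r : ℝ => r * Real.exp (-c * r)) atTop (𝓝 0) := by
  simpa using tendsto_rpow_mul_exp_neg_mul_atTop_nhds_zero 1 c hc

lemma norm_exp_neg_mul_ofReal (c : ℂ) (r : ℝ) :
    ‖Complex.exp (-c * r)‖ = Real.exp (-c.re * r) := by
  rw [Complex.norm_exp]; simp

lemma integral_mul_exp_neg {c : ℂ} (hc : 0 < c.re) :
    ∫ r in Set.Ioi (0 : ℝ), (r : ℂ) * Complex.exp (-c * r) = 1 / c ^ 2 := by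
  have hc0 : c ≠ 0 := by rintro rfl; simp at hc
  have hderiv : ∀ r : ℝ, HasDerivAt
      (fun r : ℝ => -(r / c + 1 / c ^ 2) * Complex.exp (-c * r)) (r * Complex.exp (-c * r)) r := by
    intro r
    have h1 : HasDerivAt (fun r : ℝ => (r : ℂ)) 1 r := Complex.ofRealCLM.hasDerivAt
    refine ((((h1.div_const c).add_const (1 / c ^ 2)).neg).mul
      ((h1.const_mul (-c)).cexp)).congr_deriv ?_
    simp only [Pi.neg_apply]
    field_simp
    ring
  have hint : IntegrableOn (fun r : ℝ => (r : ℂ) * Complex.exp (-c * r)) (Set.Ioi 0) := by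
    refine (integrableOn_mul_exp_neg hc).mono' (by fun_prop) ?_
    filter_upwards [ae_restrict_mem measurableSet_Ioi] with r hr
    rw [norm_mul, Complex.norm_real, Real.norm_of_nonneg (le_of_lt hr), norm_exp_neg_mul_ofReal]
  have hlim : Tendsto (fun r : ℝ => -(r / c + 1 / c ^ 2) * Complex.exp (-c * r)) atTop (𝓝 0) := by
    have h1 : Tendsto (fun r : ℝ => (r : ℂ) * Complex.exp (-c * r)) atTop (𝓝 0) := by
      refine squeeze_zero_norm' ?_ (tendsto_mul_exp_neg hc)
      filter_upwards [eventually_ge_atTop 0] with r hr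
      rw [norm_mul, Complex.norm_real, Real.norm_of_nonneg hr, norm_exp_neg_mul_ofReal]
    have h2 : Tendsto (fun r : ℝ => Complex.exp (-c * r)) atTop (𝓝 0) := by
      refine squeeze_zero_norm (fun r => (norm_exp_neg_mul_ofReal c r).le) ?_
      exact Real.tendsto_exp_atBot.comp
        (tendsto_id.const_mul_atTop_of_neg (neg_neg_iff_pos.2 hc))
    have := (h1.mul_const (-c⁻¹)).sub (h2.mul_const (1 / c ^ 2))
    simp only [zero_mul, sub_zero] at this
    refine this.congr fun r => ?_
    ring
  rw [integral_Ioi_of_hasDerivAt_of_tendsto' (fun r _ => hderiv r) hint hlim]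
  simp

lemma one_add_exp_mem_slitPlane {v : ℂ} (hv : |v.im| < Real.pi) :
    1 + Complex.exp v ∈ Complex.slitPlane := by
  rw [Complex.mem_slitPlane_iff]
  have hv' := abs_lt.1 hv
  by_cases h : v.im = 0
  · left
    rw [Complex.add_re, Complex.exp_re, h, Real.cos_zero, Complex.one_re]
    positivity
  · right
    rw [Complex.add_im, Complex.exp_im, Complex.one_im, zero_add]
    refine mul_ne_zero (Real.exp_ne_zero _) fun hs => h ?_
    exact (Real.sin_eq_zero_iff_of_lt_of_lt hv'.1 hv'.2).1 hs

/-- The substitution `t = e^{-r}` in the definition of the dilogarithm. -/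
lemma Li2_neg_exp_eq_integral_log (z : ℂ) :
    Li2 (-Complex.exp z) =
      -∫ r in Set.Ioi (0 : ℝ), Complex.log (1 + Complex.exp (z - r)) := by
  have himage : (fun r : ℝ => Real.exp (-r)) '' Set.Ioi 0 = Set.Ioo 0 1 := by
    ext t
    constructor
    · rintro ⟨r, hr, rfl⟩
      exact ⟨Real.exp_pos _, by simpa using hr⟩
    · rintro ⟨h0, h1⟩
      exact ⟨-Real.log t, neg_pos.2 (Real.log_neg h0 h1), by simp [Real.exp_log h0]⟩
  have hderiv : ∀ r ∈ Set.Ioi (0 : ℝ),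
      HasDerivWithinAt (fun r : ℝ => Real.exp (-r)) (-Real.exp (-r)) (Set.Ioi 0) r := by
    intro r _
    simpa using ((hasDerivAt_id r).neg.exp).hasDerivWithinAt
  rw [Li2, intervalIntegral.integral_of_le zero_le_one, integral_Ioc_eq_integral_Ioo, ← himage,
    integral_image_eq_integral_abs_deriv_smul measurableSet_Ioi hderiv
      (fun x _ y _ h => neg_injective (Real.exp_injective h))]
  congr 2 with r
  rw [abs_neg, abs_of_pos (Real.exp_pos _), Complex.real_smul,
    mul_div_cancel₀ _ (by exact_mod_cast (Real.exp_pos (-r)).ne'), neg_mul, sub_neg_eq_add]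
  push_cast
  rw [← Complex.exp_add, sub_eq_add_neg]

/-- Integration by parts turns the logarithm into a Fermi–Dirac integrand. -/
lemma Li2_neg_exp_eq_integral {z : ℂ} (hz : |z.im| < Real.pi) :
    Li2 (-Complex.exp z) =
      -∫ r in Set.Ioi (0 : ℝ), (r : ℂ) * (1 / (1 + Complex.exp (-(z - r)))) := by
  rw [Li2_neg_exp_eq_integral_log, neg_inj]
  have him : ∀ r : ℝ, |(z - r).im| < Real.pi := by simpa using hz
  set u : ℝ → ℂ := fun r => Complex.log (1 + Complex.exp (z - r)) with hu
  set u' : ℝ → ℂ := fun r => -(1 / (1 + Complex.exp (-(z - r)))) with hu'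
  have hderiv : ∀ r : ℝ, HasDerivAt u (u' r) r := by
    intro r
    have h1 : HasDerivAt (fun r : ℝ => (r : ℂ)) 1 r := Complex.ofRealCLM.hasDerivAt
    refine (((h1.const_sub z).cexp.const_add 1).clog_real
      (one_add_exp_mem_slitPlane (him r))).congr_deriv ?_
    have hne := one_add_exp_neg_ne_zero (him r)
    have hne' := Complex.slitPlane_ne_zero (one_add_exp_mem_slitPlane (him r))
    have hexp : Complex.exp (z - r) * Complex.exp (-(z - r)) = 1 := by
      rw [← Complex.exp_add, add_neg_cancel, Complex.exp_zero]
    rw [hu']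
    field_simp
    linear_combination -hexp
  have hucont : Continuous u := continuous_iff_continuousAt.2 fun r => (hderiv r).continuousAt
  have hu'cont : Continuous u' := by
    refine (Continuous.div (by fun_prop) (by fun_prop) fun r => ?_).neg
    exact one_add_exp_neg_ne_zero (him r)
  have hubound : ∀ᶠ r : ℝ in atTop, ‖u r‖ ≤ 3 / 2 * Real.exp z.re * Real.exp (-1 * r) := by
    have hsmall : Tendsto (fun r : ℝ => Real.exp (z.re - r)) atTop (𝓝 0) :=
      Real.tendsto_exp_atBot.comp (tendsto_atBot_add_const_left _ _ tendsto_neg_atTop_atBot)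
    filter_upwards [hsmall.eventually_le_const (u := 1 / 2) (by norm_num)] with r hr
    have hnorm : ‖Complex.exp (z - r)‖ = Real.exp (z.re - r) := by
      rw [Complex.norm_exp]; simp
    have := Complex.norm_log_one_add_half_le_self (z := Complex.exp (z - r)) (by rwa [hnorm])
    rw [hnorm, sub_eq_add_neg z.re, Real.exp_add] at this
    rw [neg_one_mul, mul_assoc]
    exact this
  have huint : IntegrableOn u (Set.Ioi 0) := by
    refine (integrable_norm_iff hucont.aestronglyMeasurable).1
      (integrable_of_isBigO_exp_neg one_pos hucont.norm.continuousOn ?_)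
    refine Asymptotics.IsBigO.of_bound (3 / 2 * Real.exp z.re) ?_
    filter_upwards [hubound] with r hr
    rwa [norm_norm, Real.norm_of_nonneg (Real.exp_pos _).le]
  have hu'bound : ∀ r : ℝ, 0 ≤ r → ‖u' r * r‖ ≤
      (Real.cos (z.im / 2))⁻¹ * Real.exp z.re * (r * Real.exp (-1 * r)) := by
    intro r hr
    have := norm_inv_one_add_exp_neg_le_exp (him r)
    rw [Complex.sub_im, Complex.ofReal_im, sub_zero, Complex.sub_re, Complex.ofReal_re,
      sub_eq_add_neg z.re, Real.exp_add] at this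
    rw [norm_mul, hu', norm_neg, Complex.norm_real, Real.norm_of_nonneg hr, neg_one_mul]
    nlinarith
  have hu'int : IntegrableOn (fun r : ℝ => u' r * r) (Set.Ioi 0) := by
    refine ((integrableOn_mul_exp_neg one_pos).const_mul
      ((Real.cos (z.im / 2))⁻¹ * Real.exp z.re)).mono' (by fun_prop) ?_
    filter_upwards [ae_restrict_mem measurableSet_Ioi] with r hr
    exact hu'bound r (le_of_lt hr)
  have huint' : IntegrableOn (fun r : ℝ => u r * 1) (Set.Ioi 0) := by simpa using huint
  have hzero : Tendsto (u * fun r : ℝ => (r : ℂ)) (𝓝[>] 0) (𝓝 0) := by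
    have : Continuous (u * fun r : ℝ => (r : ℂ)) := hucont.mul Complex.continuous_ofReal
    simpa using (this.tendsto 0).mono_left nhdsWithin_le_nhds
  have hinfty : Tendsto (u * fun r : ℝ => (r : ℂ)) atTop (𝓝 0) := by
    have hlim := (tendsto_mul_exp_neg one_pos).const_mul (3 / 2 * Real.exp z.re)
    rw [mul_zero] at hlim
    refine squeeze_zero_norm' ?_ hlim
    filter_upwards [hubound, eventually_ge_atTop 0] with r hr hr0
    rw [Pi.mul_apply, norm_mul, Complex.norm_real, Real.norm_of_nonneg hr0]
    nlinarith
  have hparts := integral_Ioi_deriv_mul_eq_sub (fun r _ => hderiv r)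
    (fun r _ => (Complex.ofRealCLM.hasDerivAt (x := r))) (hu'int.add huint') hzero hinfty
  simp only [Complex.ofRealCLM_apply, Complex.ofReal_one] at hparts
  rw [integral_add hu'int huint', sub_zero] at hparts
  simp only [mul_one] at hparts
  rw [← sub_eq_zero, ← hparts, sub_eq_add_neg, add_comm, ← integral_neg]
  congr 2 with r
  rw [hu']
  ring

/-- The double pole `1 / s² = -∫₀^∞ r e^{isr} dr` averages `1 / (1 + e^{-(z - r)})` with weight `r`,
which gives the dilogarithm. -/
theorem integral_kernel_div_sq {z : ℂ} (hz : |z.im| < Real.pi) {δ : ℝ} (h0 : 0 < δ) (h1 : δ < 1) :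
    ∫ t : ℝ, kernel z (t + δ * Complex.I) * (1 / ((t : ℂ) + δ * Complex.I) ^ 2) =
      -Complex.I * Li2 (-Complex.exp z) := by
  have hw : IntegrableOn (fun r : ℝ => (r : ℂ) * Complex.exp (((-1 : ℝ) * δ : ℝ) * r))
      (Set.Ioi 0) := by
    refine IntegrableOn.congr_fun (integrableOn_mul_exp_neg h0).ofReal (fun r _ => ?_)
      measurableSet_Ioi
    change ((r * Real.exp (-δ * r) : ℝ) : ℂ) = _
    push_cast
    ring_nf
  have h := integral_mul_inv_one_add_exp hz h0 h1 (-1) hw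
  have hinner : ∀ t : ℝ, ∫ r in Set.Ioi (0 : ℝ), (r : ℂ) *
      Complex.exp (-Complex.I * (t + δ * Complex.I) * ((-1 : ℝ) * r)) =
      -(1 / ((t : ℂ) + δ * Complex.I) ^ 2) := by
    intro t
    have := integral_mul_exp_neg (c := -Complex.I * (t + δ * Complex.I)) (by simpa using h0)
    rw [mul_pow, neg_sq, Complex.I_sq, neg_one_mul, one_div_neg_eq_neg_one_div] at this
    rw [← this]
    congr 1 with r
    congr 2
    push_cast
    ring
  simp_rw [hinner, mul_neg] at h
  rw [integral_neg] at h
  rw [Li2_neg_exp_eq_integral hz]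
  have h' : ∀ r : ℝ, -(z - r) = -(z + (-1 : ℝ) * r) := fun r => by push_cast; ring
  simp_rw [h']
  rw [h]
  linear_combination (∫ t : ℝ, kernel z (t + δ * Complex.I) *
    (1 / ((t : ℂ) + δ * Complex.I) ^ 2)) * Complex.I_sq

/-! ### Partial fractions of the hyperbolic cosecant -/

/-- Partial fractions of the cosecant, from those of the cotangent and
`1 / sin 2θ = cot θ - cot 2θ`: the cotangent series at `x / 2` consists of the terms of even index
of the series at `x`, doubled. -/
theorem hasSum_csc {x : ℂ} (hx : x ∈ Complex.integerComplement) :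
    HasSum (fun n : ℕ => (-1) ^ (n + 1) * cotTerm x n)
      (Real.pi / Complex.sin (Real.pi * x) - 1 / x) := by
  have hx2 : x / 2 ∈ Complex.integerComplement := by
    rintro ⟨k, hk⟩
    exact hx ⟨2 * k, by push_cast; rw [hk]; ring⟩
  have hx0 := Complex.integerComplement.ne_zero hx
  have hall : HasSum (fun n => cotTerm x n) (Real.pi * Complex.cot (Real.pi * x) - 1 / x) := by
    rw [cot_series_rep' hx]; exact (summable_cotTerm hx).hasSum
  have hhalf : HasSum (fun n => cotTerm (x / 2) n)
      (Real.pi * Complex.cot (Real.pi * (x / 2)) - 1 / (x / 2)) := by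
    rw [cot_series_rep' hx2]; exact (summable_cotTerm hx2).hasSum
  have hinj : Function.Injective fun m : ℕ => 2 * m + 1 := fun m m' h => by
    simp only at h; omega
  have heven : HasSum (fun n : ℕ => if Odd n then 2 * cotTerm x n else 0)
      (Real.pi * Complex.cot (Real.pi * (x / 2)) - 1 / (x / 2)) := by
    rw [← hinj.hasSum_iff]
    · refine hhalf.congr_fun fun m => ?_
      have hodd : Odd (2 * m + 1) := ⟨m, rfl⟩
      simp only [Function.comp, hodd, if_true, cotTerm]
      push_cast
      rw [show x / 2 - (m + 1) = (x - (2 * m + 1 + 1)) / 2 by ring,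
        show x / 2 + (m + 1) = (x + (2 * m + 1 + 1)) / 2 by ring, one_div_div, one_div_div]
      ring
    · intro n hn
      rw [if_neg]
      rintro ⟨m, rfl⟩
      exact hn ⟨m, rfl⟩
  have hval : Real.pi / Complex.sin (Real.pi * x) - 1 / x =
      (Real.pi * Complex.cot (Real.pi * (x / 2)) - 1 / (x / 2)) -
        (Real.pi * Complex.cot (Real.pi * x) - 1 / x) := by
    have h1 := sin_pi_mul_ne_zero hx
    have h2 := sin_pi_mul_ne_zero hx2
    rw [show Real.pi * x = 2 * (Real.pi * (x / 2)) by ring] at h1 ⊢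
    generalize (Real.pi : ℂ) * (x / 2) = θ at *
    rw [Complex.cot, Complex.cot]
    rw [Complex.sin_two_mul, Complex.cos_two_mul] at *
    have h3 : Complex.cos θ ≠ 0 := by rintro h; simp [h] at h1
    field_simp
    ring
  rw [hval]
  refine (heven.sub hall).congr_fun fun n => ?_
  by_cases h : Odd n
  · rw [if_pos h, (h.add_one).neg_one_pow]; ring
  · rw [if_neg h, (Nat.not_odd_iff_even.1 h).add_one.neg_one_pow]; ring

lemma sin_pi_mul_mul_pos {τ y : ℝ} (hτ : 0 < τ) (h0 : 0 < y) (h1 : τ * y < 1) :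
    0 < Real.sin (Real.pi * (τ * y)) :=
  sin_pi_mul_pos (by positivity) h1

/-- Partial fractions of `π / (s sinh πτs)`, which is `hasSum_csc` at the point `iτs`. -/
theorem hasSum_inv_mul_sinh {τ : ℝ} (hτ : 0 < τ) {s : ℂ} (h0 : 0 < s.im) (h1 : τ * s.im < 1) :
    HasSum (fun n : ℕ => (-1) ^ (n + 1) * (2 * τ / (((n : ℂ) + 1) ^ 2 + τ ^ 2 * s ^ 2)))
      (Real.pi / (s * Complex.sinh (Real.pi * (τ * s))) - 1 / (τ * s ^ 2)) := by
  have hs : s ≠ 0 := by rintro rfl; simp at h0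
  have hτ' : (τ : ℂ) ≠ 0 := by exact_mod_cast hτ.ne'
  have hsinh : Complex.sinh (Real.pi * (τ * s)) ≠ 0 := by
    refine sinh_ne_zero_of_sin_im_ne_zero ?_
    rw [Complex.im_ofReal_mul, Complex.im_ofReal_mul]
    exact (sin_pi_mul_mul_pos hτ h0 h1).ne'
  -- The real part of `iτs` lies strictly between `-1` and `0`.
  have hx : Complex.I * (τ * s) ∈ Complex.integerComplement := by
    rintro ⟨k, hk⟩
    have hre := congrArg Complex.re hk
    rw [Complex.I_mul_re, Complex.im_ofReal_mul, Complex.intCast_re] at hre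
    have hneg : (k : ℝ) < 0 := by rw [hre]; nlinarith
    have hgt : (-1 : ℝ) < k := by rw [hre]; linarith
    have h3 : k < 0 := by exact_mod_cast hneg
    have h4 : -1 < k := by exact_mod_cast hgt
    omega
  have h := (hasSum_csc hx).mul_left (Complex.I / s)
  have hval : Complex.I / s * (Real.pi / Complex.sin (Real.pi * (Complex.I * (τ * s))) -
      1 / (Complex.I * (τ * s))) =
      Real.pi / (s * Complex.sinh (Real.pi * (τ * s))) - 1 / (τ * s ^ 2) := by
    rw [show Real.pi * (Complex.I * (τ * s)) = Real.pi * (τ * s) * Complex.I by ring,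
      Complex.sin_mul_I]
    field_simp
  rw [hval] at h
  refine h.congr_fun fun n => ?_
  have hne := Complex.integerComplement_add_ne_zero hx (n + 1)
  have hne' := Complex.integerComplement_add_ne_zero hx (-(n + 1))
  push_cast at hne hne'
  have hprod : ((n : ℂ) + 1) ^ 2 + τ ^ 2 * s ^ 2 =
      -((Complex.I * (τ * s) + (n + 1)) * (Complex.I * (τ * s) + -(n + 1))) := by
    linear_combination ((τ * s) ^ 2 : ℂ) * Complex.I_sq
  rw [cotTerm_identity hx, hprod, sub_eq_add_neg]
  have : Complex.I / s * ((-1) ^ (n + 1) * (2 * (Complex.I * (τ * s)) *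
      (1 / ((Complex.I * (τ * s) + (n + 1)) * (Complex.I * (τ * s) + -(n + 1)))))) =
      (-1) ^ (n + 1) * (Complex.I ^ 2 * (2 * τ) /
        ((Complex.I * (τ * s) + (n + 1)) * (Complex.I * (τ * s) + -(n + 1)))) := by
    field_simp
  rw [this, Complex.I_sq, div_neg]
  ring

lemma norm_two_mul_div_le {τ : ℝ} (hτ : 0 < τ) {s : ℂ} (h0 : 0 < s.im) (h1 : τ * s.im < 1)
    (n : ℕ) :
    ‖2 * (τ : ℂ) / (((n : ℂ) + 1) ^ 2 + τ ^ 2 * s ^ 2)‖ ≤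
      2 * τ / (1 - τ * s.im) ^ 2 * (1 / ((n : ℝ) + 1) ^ 2) := by
  have hn : (1 : ℝ) ≤ (n : ℝ) + 1 := by linarith [(Nat.cast_nonneg n : (0 : ℝ) ≤ n)]
  have hpos : 0 < 1 - τ * s.im := by linarith
  -- Both factors of `(n + 1)² + τ²s²` have real part at least `(n + 1) (1 - τ Im s)`.
  have hfac : ((n : ℂ) + 1) ^ 2 + τ ^ 2 * s ^ 2 =
      (((n + 1 : ℝ) : ℂ) + Complex.I * ((τ : ℝ) * s)) *
        (((n + 1 : ℝ) : ℂ) - Complex.I * ((τ : ℝ) * s)) := by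
    push_cast
    linear_combination ((τ * s) ^ 2 : ℂ) * Complex.I_sq
  have hre1 : ((n : ℝ) + 1) * (1 - τ * s.im) ≤
      ‖((n + 1 : ℝ) : ℂ) + Complex.I * ((τ : ℝ) * s)‖ := by
    refine le_trans ?_ (Complex.re_le_norm _)
    rw [Complex.add_re, Complex.I_mul_re, Complex.im_ofReal_mul, Complex.ofReal_re]
    nlinarith [mul_pos hτ h0]
  have hre2 : ((n : ℝ) + 1) * (1 - τ * s.im) ≤
      ‖((n + 1 : ℝ) : ℂ) - Complex.I * ((τ : ℝ) * s)‖ := by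
    refine le_trans ?_ (Complex.re_le_norm _)
    rw [Complex.sub_re, Complex.I_mul_re, Complex.im_ofReal_mul, Complex.ofReal_re]
    nlinarith [mul_pos hτ h0]
  have hlow : 0 < ((n : ℝ) + 1) * (1 - τ * s.im) := by positivity
  rw [norm_div, hfac, norm_mul, norm_mul, Complex.norm_two, Complex.norm_real,
    Real.norm_of_nonneg hτ.le]
  calc _ ≤ 2 * τ / ((((n : ℝ) + 1) * (1 - τ * s.im)) * (((n : ℝ) + 1) * (1 - τ * s.im))) := by
        gcongr
    _ = _ := by field_simp

lemma summable_one_div_add_one_sq : Summable fun n : ℕ => 1 / ((n : ℝ) + 1) ^ 2 := by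
  have := (summable_nat_add_iff 1).2 (Real.summable_one_div_nat_pow.2 one_lt_two)
  simpa using this

/-! ### The series `G` and its Laplace transform -/

lemma GTerm_ofReal (ξ : ℝ) (z : ℂ) (n : ℕ) :
    GTerm ξ z n = (-1) ^ (n + 1) / ((n : ℂ) + 1) ^ 2 *
      (1 / (1 + Complex.exp (-(z + (-((n : ℝ) + 1)⁻¹ : ℝ) * ξ))) +
        1 / (1 + Complex.exp (-(z + (((n : ℝ) + 1)⁻¹ : ℝ) * ξ)))) := by
  rw [GTerm]
  push_cast
  ring_nf

lemma norm_neg_one_pow_div_sq (n : ℕ) :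
    ‖(-1 : ℂ) ^ (n + 1) / ((n : ℂ) + 1) ^ 2‖ = 1 / ((n : ℝ) + 1) ^ 2 := by
  have : ‖(n : ℂ) + 1‖ = (n : ℝ) + 1 := by
    exact_mod_cast Complex.norm_natCast (n + 1)
  rw [norm_div, norm_pow, norm_pow, norm_neg, norm_one, one_pow, this]

lemma norm_inv_one_add_exp_add_le {z : ℂ} (hz : |z.im| < Real.pi) (a ξ : ℝ) :
    ‖1 / (1 + Complex.exp (-(z + a * ξ)))‖ ≤ (Real.cos (z.im / 2))⁻¹ := by
  have := norm_inv_one_add_exp_neg_le_inv_cos (v := z + a * ξ)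
    (by rwa [im_add_ofReal_mul_ofReal])
  rwa [im_add_ofReal_mul_ofReal] at this

lemma norm_GTerm_le {z : ℂ} (hz : |z.im| < Real.pi) (ξ : ℝ) (n : ℕ) :
    ‖GTerm ξ z n‖ ≤ 1 / ((n : ℝ) + 1) ^ 2 * (2 * (Real.cos (z.im / 2))⁻¹) := by
  rw [GTerm_ofReal, norm_mul, norm_neg_one_pow_div_sq, two_mul]
  gcongr
  exact (norm_add_le _ _).trans
    (add_le_add (norm_inv_one_add_exp_add_le hz _ ξ) (norm_inv_one_add_exp_add_le hz _ ξ))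

lemma continuous_inv_one_add_exp {z : ℂ} (hz : |z.im| < Real.pi) (a : ℝ) :
    Continuous fun ξ : ℝ => 1 / (1 + Complex.exp (-(z + a * ξ))) :=
  Continuous.div (by fun_prop) (by fun_prop) fun ξ =>
    one_add_exp_neg_ne_zero (by rwa [im_add_ofReal_mul_ofReal])

lemma continuous_GTerm {z : ℂ} (hz : |z.im| < Real.pi) (n : ℕ) :
    Continuous fun ξ : ℝ => GTerm ξ z n := by
  simp_rw [GTerm_ofReal]
  exact ((continuous_inv_one_add_exp hz _).add (continuous_inv_one_add_exp hz _)).const_mul _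

lemma summable_GTerm {z : ℂ} (hz : |z.im| < Real.pi) (ξ : ℝ) : Summable (GTerm ξ z) :=
  .of_norm_bounded (summable_one_div_add_one_sq.mul_right _) (norm_GTerm_le hz ξ)

lemma norm_exp_neg_div (ξ τ : ℝ) :
    ‖Complex.exp (-(ξ : ℂ) / τ)‖ = Real.exp (-τ⁻¹ * ξ) := by
  rw [← Complex.ofReal_neg, ← Complex.ofReal_div, ← Complex.ofReal_exp, Complex.norm_real,
    Real.norm_of_nonneg (Real.exp_pos _).le]
  ring_nf

lemma integrableOn_exp_neg_div {τ : ℝ} (hτ : 0 < τ) :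
    IntegrableOn (fun ξ : ℝ => Real.exp (-τ⁻¹ * ξ)) (Set.Ioi 0) :=
  integrableOn_exp_mul_Ioi (neg_neg_iff_pos.2 (inv_pos.2 hτ)) 0

lemma integrableOn_exp_mul_G {τ : ℝ} (hτ : 0 < τ) {z : ℂ} (hz : |z.im| < Real.pi) :
    IntegrableOn (fun ξ : ℝ => Complex.exp (-(ξ : ℂ) / τ) * G ξ z) (Set.Ioi 0) := by
  have hsum := summable_one_div_add_one_sq.mul_right (2 * (Real.cos (z.im / 2))⁻¹)
  have hcont : Continuous fun ξ : ℝ => G ξ z :=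
    (continuous_tsum (continuous_GTerm hz) hsum fun n ξ => norm_GTerm_le hz ξ n).const_mul _
  refine Integrable.mono' ((integrableOn_exp_neg_div hτ).mul_const
    (‖1 / (2 * Real.pi * Complex.I)‖ *
      ∑' n : ℕ, 1 / ((n : ℝ) + 1) ^ 2 * (2 * (Real.cos (z.im / 2))⁻¹)))
    (by fun_prop) (Eventually.of_forall fun ξ => ?_)
  rw [norm_mul, norm_exp_neg_div, G, norm_mul]
  gcongr
  exact tsum_of_norm_bounded hsum.hasSum (norm_GTerm_le hz ξ)

lemma hasSum_integral_exp_mul_GTerm {τ : ℝ} (hτ : 0 < τ) {z : ℂ} (hz : |z.im| < Real.pi) :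
    HasSum (fun n : ℕ => ∫ ξ in Set.Ioi (0 : ℝ), Complex.exp (-(ξ : ℂ) / τ) * GTerm ξ z n)
      (∫ ξ in Set.Ioi (0 : ℝ), Complex.exp (-(ξ : ℂ) / τ) * ∑' n : ℕ, GTerm ξ z n) := by
  have hsum := summable_one_div_add_one_sq.mul_right (2 * (Real.cos (z.im / 2))⁻¹)
  refine hasSum_integral_of_dominated_convergence
    (fun n ξ => Real.exp (-τ⁻¹ * ξ) * (1 / ((n : ℝ) + 1) ^ 2 * (2 * (Real.cos (z.im / 2))⁻¹)))
    (fun n => ?_) (fun n => ?_) ?_ ?_ ?_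
  · have := continuous_GTerm hz n
    exact (by fun_prop : Continuous fun ξ : ℝ =>
      Complex.exp (-(ξ : ℂ) / τ) * GTerm ξ z n).aestronglyMeasurable
  · refine Eventually.of_forall fun ξ => ?_
    rw [norm_mul, norm_exp_neg_div]
    gcongr
    exact norm_GTerm_le hz ξ n
  · exact Eventually.of_forall fun ξ => hsum.mul_left _
  · simp_rw [tsum_mul_left]
    exact (integrableOn_exp_neg_div hτ).mul_const _
  · exact Eventually.of_forall fun ξ => (summable_GTerm hz ξ).hasSum.mul_left _

lemma integral_exp_mul_inv_one_add_exp {τ : ℝ} {z : ℂ} (hz : |z.im| < Real.pi)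
    {δ : ℝ} (h0 : 0 < δ) (h1 : δ < 1) {a : ℝ} (ha : a * δ < τ⁻¹) :
    ∫ ξ in Set.Ioi (0 : ℝ), Complex.exp (-(ξ : ℂ) / τ) *
        (1 / (1 + Complex.exp (-(z + a * ξ)))) =
      Complex.I * ∫ t : ℝ, kernel z (t + δ * Complex.I) *
        (1 / ((τ : ℂ)⁻¹ + Complex.I * (t + δ * Complex.I) * a)) := by
  rw [integral_mul_inv_one_add_exp hz h0 h1 a]
  · congr 2 with t
    congr 1
    have hre : (-((τ : ℂ)⁻¹ + Complex.I * (t + δ * Complex.I) * a)).re < 0 := by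
      rw [← Complex.ofReal_inv]
      simp
      linarith
    have := integral_exp_mul_complex_Ioi hre 0
    rw [Complex.ofReal_zero, mul_zero, Complex.exp_zero, neg_div_neg_eq] at this
    rw [← this]
    congr 1 with ξ
    rw [← Complex.exp_add]
    congr 1
    ring
  · have hre : ((((a * δ - τ⁻¹ : ℝ)) : ℂ)).re < 0 := by
      rw [Complex.ofReal_re]; linarith
    refine IntegrableOn.congr_fun (integrableOn_exp_mul_complex_Ioi hre 0) (fun ξ _ => ?_)
      measurableSet_Ioi
    rw [← Complex.exp_add]
    congr 1
    push_cast
    ring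

lemma integrable_kernel_mul {z : ℂ} (hz : |z.im| < Real.pi) {δ : ℝ} (h0 : 0 < δ) (h1 : δ < 1)
    {g : ℝ → ℂ} {C : ℝ} (hg : Continuous g) (hC : ∀ t, ‖g t‖ ≤ C) :
    Integrable fun t : ℝ => kernel z (t + δ * Complex.I) * g t :=
  (integrable_kernel_line hz h0 h1).mul_bdd (c := C) hg.aestronglyMeasurable (Eventually.of_forall hC)

/-- The Laplace transform of the term of `2πi G` with index `n + 1` corresponds to the partial
fraction of `π / (s sinh πτs)` with the same index. -/
lemma integral_exp_mul_GTerm {τ : ℝ} (hτ : 0 < τ) {z : ℂ} (hz : |z.im| < Real.pi)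
    {δ : ℝ} (h0 : 0 < δ) (h1 : δ < 1) (h2 : τ * δ < 1) (n : ℕ) :
    ∫ ξ in Set.Ioi (0 : ℝ), Complex.exp (-(ξ : ℂ) / τ) * GTerm ξ z n =
      Complex.I * ∫ t : ℝ, kernel z (t + δ * Complex.I) *
        ((-1) ^ (n + 1) *
          (2 * τ / (((n : ℂ) + 1) ^ 2 + τ ^ 2 * ((t : ℂ) + δ * Complex.I) ^ 2))) := by
  have hn : (0 : ℝ) < (n : ℝ) + 1 := by positivity
  have hnC : (n : ℂ) + 1 ≠ 0 := Nat.cast_add_one_ne_zero n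
  have hτC : (τ : ℂ) ≠ 0 := by exact_mod_cast hτ.ne'
  have hδτ : δ < τ⁻¹ := by rw [← one_div, lt_div_iff₀ hτ]; linarith
  have hle : ((n : ℝ) + 1)⁻¹ * δ ≤ δ :=
    mul_le_of_le_one_left h0.le
      (inv_le_one_of_one_le₀ (by linarith [(Nat.cast_nonneg n : (0 : ℝ) ≤ n)]))
  have ha1 : ((n : ℝ) + 1)⁻¹ * δ < τ⁻¹ := by linarith
  have ha2 : -((n : ℝ) + 1)⁻¹ * δ < τ⁻¹ := by
    have : 0 < ((n : ℝ) + 1)⁻¹ * δ := by positivity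
    have := inv_pos.2 hτ
    linarith
  have hint : ∀ a : ℝ, IntegrableOn (fun ξ : ℝ => Complex.exp (-(ξ : ℂ) / τ) *
      (1 / (1 + Complex.exp (-(z + a * ξ))))) (Set.Ioi 0) := by
    intro a
    have hc := continuous_inv_one_add_exp hz a
    refine Integrable.mono' ((integrableOn_exp_neg_div hτ).mul_const (Real.cos (z.im / 2))⁻¹)
      (by fun_prop) (Eventually.of_forall fun ξ => ?_)
    rw [norm_mul, norm_exp_neg_div]
    gcongr
    exact norm_inv_one_add_exp_add_le hz a ξ
  have hrepos : ∀ a : ℝ, a * δ < τ⁻¹ → ∀ t : ℝ, τ⁻¹ - a * δ ≤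
      ‖(τ : ℂ)⁻¹ + Complex.I * (t + δ * Complex.I) * a‖ := by
    intro a _ t
    refine le_trans (le_of_eq ?_) (Complex.re_le_norm _)
    rw [← Complex.ofReal_inv]
    simp
    ring
  have hne : ∀ a : ℝ, a * δ < τ⁻¹ → ∀ t : ℝ,
      (τ : ℂ)⁻¹ + Complex.I * (t + δ * Complex.I) * a ≠ 0 := by
    intro a ha t
    rw [← norm_pos_iff]
    exact (sub_pos.2 ha).trans_le (hrepos a ha t)
  have hkint : ∀ a : ℝ, a * δ < τ⁻¹ → Integrable fun t : ℝ => kernel z (t + δ * Complex.I) *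
      (1 / ((τ : ℂ)⁻¹ + Complex.I * (t + δ * Complex.I) * a)) := by
    intro a ha
    refine integrable_kernel_mul hz h0 h1 (C := (τ⁻¹ - a * δ)⁻¹)
      (Continuous.div (by fun_prop) (by fun_prop) (hne a ha)) fun t => ?_
    rw [norm_div, norm_one, one_div]
    exact inv_anti₀ (sub_pos.2 ha) (hrepos a ha t)
  have hterm : ∀ ξ : ℝ, Complex.exp (-(ξ : ℂ) / τ) * GTerm ξ z n =
      (-1) ^ (n + 1) / ((n : ℂ) + 1) ^ 2 *
        (Complex.exp (-(ξ : ℂ) / τ) *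
          (1 / (1 + Complex.exp (-(z + (-((n : ℝ) + 1)⁻¹ : ℝ) * ξ)))) +
        Complex.exp (-(ξ : ℂ) / τ) *
          (1 / (1 + Complex.exp (-(z + (((n : ℝ) + 1)⁻¹ : ℝ) * ξ))))) := by
    intro ξ
    rw [GTerm_ofReal]
    ring
  simp_rw [hterm]
  rw [integral_const_mul, integral_add (hint _) (hint _),
    integral_exp_mul_inv_one_add_exp hz h0 h1 ha1,
    integral_exp_mul_inv_one_add_exp hz h0 h1 ha2, ← mul_add,
    ← integral_add (hkint _ ha2) (hkint _ ha1), mul_left_comm, ← integral_const_mul]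
  congr 2 with t
  have hne1 := hne _ ha1 t
  have hne2 := hne _ ha2 t
  generalize (t : ℂ) + δ * Complex.I = s at *
  have hfac : ((n : ℂ) + 1) ^ 2 + τ ^ 2 * s ^ 2 = ((n : ℂ) + 1) ^ 2 * τ ^ 2 *
      (((τ : ℂ)⁻¹ + Complex.I * s * (((n : ℝ) + 1)⁻¹ : ℝ)) *
        ((τ : ℂ)⁻¹ + Complex.I * s * (-((n : ℝ) + 1)⁻¹ : ℝ))) := by
    push_cast
    field_simp
    linear_combination ((τ * s) ^ 2 : ℂ) * Complex.I_sq
  rw [hfac, ← mul_add, one_div_add_one_div hne2 hne1]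
  have hsum : (τ : ℂ)⁻¹ + Complex.I * s * (-((n : ℝ) + 1)⁻¹ : ℝ) +
      ((τ : ℂ)⁻¹ + Complex.I * s * (((n : ℝ) + 1)⁻¹ : ℝ)) = 2 / τ := by
    push_cast
    ring
  rw [hsum]
  field_simp

/-- The Laplace transform of `2πi G`, summed over the terms of `G` and written as an integral of
the kernel. -/
theorem integral_exp_mul_tsum_GTerm {τ : ℝ} (hτ : 0 < τ) {z : ℂ} (hz : |z.im| < Real.pi)
    {δ : ℝ} (h0 : 0 < δ) (h1 : δ < 1) (h2 : τ * δ < 1) :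
    ∫ ξ in Set.Ioi (0 : ℝ), Complex.exp (-(ξ : ℂ) / τ) * ∑' n : ℕ, GTerm ξ z n =
      Complex.I * ∫ t : ℝ, kernel z (t + δ * Complex.I) *
        (Real.pi / (((t : ℂ) + δ * Complex.I) *
            Complex.sinh (Real.pi * (τ * ((t : ℂ) + δ * Complex.I)))) -
          1 / (τ * ((t : ℂ) + δ * Complex.I) ^ 2)) := by
  have him : ∀ t : ℝ, ((t : ℂ) + δ * Complex.I).im = δ := by simp
  have hL := hasSum_integral_exp_mul_GTerm hτ hz
  simp_rw [integral_exp_mul_GTerm hτ hz h0 h1 h2] at hL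
  refine hL.unique (HasSum.mul_left _ ?_)
  have hbound : ∀ (n : ℕ) (t : ℝ), ‖(-1) ^ (n + 1) *
      (2 * (τ : ℂ) / (((n : ℂ) + 1) ^ 2 + τ ^ 2 * ((t : ℂ) + δ * Complex.I) ^ 2))‖ ≤
      2 * τ / (1 - τ * δ) ^ 2 * (1 / ((n : ℝ) + 1) ^ 2) := by
    intro n t
    rw [norm_mul, norm_pow, norm_neg, norm_one, one_pow, one_mul]
    simpa only [him] using norm_two_mul_div_le hτ (s := (t : ℂ) + δ * Complex.I)
      (by rwa [him]) (by rwa [him]) n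
  have hsum := summable_one_div_add_one_sq.mul_left (2 * τ / (1 - τ * δ) ^ 2)
  have hk := integrable_kernel_line hz h0 h1
  refine hasSum_integral_of_dominated_convergence
    (fun n t => ‖kernel z (t + δ * Complex.I)‖ *
      (2 * τ / (1 - τ * δ) ^ 2 * (1 / ((n : ℝ) + 1) ^ 2)))
    (fun n => ?_) (fun n => ?_) ?_ ?_ ?_
  · refine hk.aestronglyMeasurable.mul (Measurable.aestronglyMeasurable ?_)
    fun_prop
  · refine Eventually.of_forall fun t => ?_
    rw [norm_mul]
    gcongr
    exact hbound n t
  · exact Eventually.of_forall fun t => hsum.mul_left _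
  · simp_rw [tsum_mul_left]
    exact hk.norm.mul_const _
  · refine Eventually.of_forall fun t => HasSum.mul_left _ ?_
    exact hasSum_inv_mul_sinh hτ (by rwa [him]) (by rwa [him])

/-! ### Faddeev's integral in the rescaled variable -/

lemma faddeevIntegrand_rescaled {τ b : ℝ} (hb : 0 < b) (hbτ : b ^ 2 = τ) (z s : ℂ) :
    faddeevIntegrand b (z / (2 * Real.pi * b)) (Real.pi * b * s) =
      ((Real.pi * b : ℝ) : ℂ)⁻¹ * (kernel z s *
        (1 / (2 * (s * Complex.sinh (Real.pi * (τ * s)))))) := by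
  have hb' : (b : ℂ) ≠ 0 := by exact_mod_cast hb.ne'
  have hpi : (Real.pi : ℂ) ≠ 0 := by exact_mod_cast Real.pi_ne_zero
  rw [faddeevIntegrand, kernel, ← hbτ,
    show -2 * Complex.I * (Real.pi * b * s) * (z / (2 * Real.pi * b)) = -Complex.I * s * z by
      field_simp,
    show (Real.pi * b * s * b : ℂ) = Real.pi * (((b ^ 2 : ℝ) : ℂ) * s) by push_cast; ring,
    show (Real.pi * b * s / b : ℂ) = Real.pi * s by field_simp, div_mul_div_comm, mul_one,
    inv_mul_eq_div, div_div]
  congr 1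
  push_cast
  ring

lemma continuous_inv_mul_sinh_line {τ : ℝ} (hτ : 0 < τ) {δ : ℝ} (h0 : 0 < δ) (h2 : τ * δ < 1) :
    Continuous fun t : ℝ => 1 / (2 * (((t : ℂ) + δ * Complex.I) *
      Complex.sinh (Real.pi * (τ * ((t : ℂ) + δ * Complex.I))))) := by
  refine Continuous.div (by fun_prop) (by fun_prop) fun t => ?_
  refine mul_ne_zero two_ne_zero (mul_ne_zero ?_ (sinh_ne_zero_of_sin_im_ne_zero ?_))
  · intro h
    have := congrArg Complex.im h
    simp [h0.ne'] at this
  · rw [Complex.im_ofReal_mul, Complex.im_ofReal_mul]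
    simpa using (sin_pi_mul_mul_pos hτ h0 h2).ne'

lemma norm_inv_mul_sinh_line_le {τ : ℝ} (hτ : 0 < τ) {δ : ℝ} (h0 : 0 < δ) (h2 : τ * δ < 1)
    (t : ℝ) :
    ‖1 / (2 * (((t : ℂ) + δ * Complex.I) *
      Complex.sinh (Real.pi * (τ * ((t : ℂ) + δ * Complex.I)))))‖ ≤
      (2 * (δ * Real.sin (Real.pi * (τ * δ))))⁻¹ := by
  have hsin := sin_pi_mul_mul_pos hτ h0 h2
  have hs : δ ≤ ‖(t : ℂ) + δ * Complex.I‖ := by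
    have := Complex.abs_im_le_norm ((t : ℂ) + δ * Complex.I)
    simpa [abs_of_pos h0] using this
  have hsinh : Real.sin (Real.pi * (τ * δ)) ≤
      ‖Complex.sinh (Real.pi * (τ * ((t : ℂ) + δ * Complex.I)))‖ := by
    have := abs_sin_im_mul_cosh_re_le_norm_sinh (Real.pi * (τ * ((t : ℂ) + δ * Complex.I)))
    rw [Complex.im_ofReal_mul, Complex.im_ofReal_mul,
      show ((t : ℂ) + δ * Complex.I).im = δ by simp, abs_of_pos hsin] at this
    exact (le_mul_of_one_le_right hsin.le (Real.one_le_cosh _)).trans this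
  rw [norm_div, norm_one, one_div, norm_mul, norm_mul, Complex.norm_two]
  refine inv_anti₀ (by positivity) ?_
  gcongr

end QDilog

open QDilog in
theorem theorem1p3 (τ b : ℝ) (hτ : 0 < τ) (hb : 0 < b) (hbτ : b ^ 2 = τ)
    (z : ℂ) (hz : |z.im| < Real.pi)
    (ε : ℝ) (hε : 0 < ε) (hεb : ε < Real.pi * b) (hεb' : ε < Real.pi / b) :
    -- the integrals and the series in the claim converge
    Integrable (fun t : ℝ =>
      faddeevIntegrand b (z / (2 * Real.pi * b)) ((t : ℂ) + ε * Complex.I)) ∧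
    (∀ ξ : ℝ, 0 ≤ ξ → Summable (GTerm ξ z)) ∧
    IntegrableOn (fun ξ : ℝ => Complex.exp (-(ξ : ℂ) / τ) * G ξ z) (Set.Ioi 0) ∧
    -- the identity of logarithms
    logPhi b ε (z / (2 * Real.pi * b)) =
      Li2 (-Complex.exp z) / (2 * Real.pi * Complex.I * τ) +
        laplace (fun ξ : ℝ => G ξ z) τ ∧
    -- its exponential
    Phi b ε (z / (2 * Real.pi * b)) =
      Complex.exp (Li2 (-Complex.exp z) / (2 * Real.pi * Complex.I * τ) +
        laplace (fun ξ : ℝ => G ξ z) τ) := by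
  have hpib : 0 < Real.pi * b := by positivity
  have hpiC : (Real.pi : ℂ) ≠ 0 := by exact_mod_cast Real.pi_ne_zero
  have hτC : (τ : ℂ) ≠ 0 := by exact_mod_cast hτ.ne'
  -- The contour `ℝ + iε` for `x = πbs` is the contour `ℝ + iδ` for `s`.
  obtain ⟨δ, hδ⟩ : ∃ δ : ℝ, δ = ε / (Real.pi * b) := ⟨_, rfl⟩
  have hεδ : ε = Real.pi * b * δ := by rw [hδ]; field_simp
  have h0 : 0 < δ := by rw [hδ]; positivity
  have h1 : δ < 1 := by rwa [hδ, div_lt_one hpib]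
  have h2 : τ * δ < 1 := by
    rw [lt_div_iff₀ hb, hεδ] at hεb'
    have : Real.pi * (τ * δ) < Real.pi * 1 := by rw [← hbτ]; linarith
    exact lt_of_mul_lt_mul_left this Real.pi_pos.le
  set F : ℝ → ℂ := fun t : ℝ =>
    faddeevIntegrand b (z / (2 * Real.pi * b)) ((t : ℂ) + ε * Complex.I) with hF
  have hscale : ∀ t : ℝ, F (Real.pi * b * t) = ((Real.pi * b : ℝ) : ℂ)⁻¹ *
      (kernel z (t + δ * Complex.I) * (1 / (2 * (((t : ℂ) + δ * Complex.I) *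
        Complex.sinh (Real.pi * (τ * ((t : ℂ) + δ * Complex.I))))))) := by
    intro t
    rw [← faddeevIntegrand_rescaled hb hbτ, hF, hεδ]
    push_cast
    congr 1
    ring
  have hkint := integrable_kernel_mul hz h0 h1 (continuous_inv_mul_sinh_line hτ h0 h2)
    (norm_inv_mul_sinh_line_le hτ h0 h2)
  have hFint : Integrable F := by
    rw [← integrable_comp_mul_left_iff F hpib.ne']
    simp_rw [hscale]
    exact hkint.const_mul _
  have hlogPhi : logPhi b ε (z / (2 * Real.pi * b)) =
      ∫ t : ℝ, kernel z (t + δ * Complex.I) * (1 / (2 * (((t : ℂ) + δ * Complex.I) *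
        Complex.sinh (Real.pi * (τ * ((t : ℂ) + δ * Complex.I)))))) := by
    have h := Measure.integral_comp_mul_left F (Real.pi * b)
    simp_rw [hscale] at h
    rw [integral_const_mul, abs_of_pos (inv_pos.2 hpib), Complex.real_smul, Complex.ofReal_inv]
      at h
    have hne : ((Real.pi * b : ℝ) : ℂ)⁻¹ ≠ 0 :=
      inv_ne_zero (by exact_mod_cast hpib.ne')
    exact (mul_left_cancel₀ hne h).symm
  have hkint2 : Integrable fun t : ℝ => kernel z (t + δ * Complex.I) *
      (1 / ((t : ℂ) + δ * Complex.I) ^ 2) := by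
    have hne : ∀ t : ℝ, δ ≤ ‖(t : ℂ) + δ * Complex.I‖ := by
      intro t
      have := Complex.abs_im_le_norm ((t : ℂ) + δ * Complex.I)
      simpa [abs_of_pos h0] using this
    refine integrable_kernel_mul hz h0 h1 (C := (δ ^ 2)⁻¹)
      (Continuous.div (by fun_prop) (by fun_prop) fun t => pow_ne_zero 2 ?_) fun t => ?_
    · exact norm_pos_iff.1 (h0.trans_le (hne t))
    · rw [norm_div, norm_one, one_div, norm_pow]
      exact inv_anti₀ (by positivity) (pow_le_pow_left₀ h0.le (hne t) 2)
  have hlaplace : laplace (fun ξ : ℝ => G ξ z) τ = 1 / (2 * Real.pi * Complex.I) *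
      ∫ ξ in Set.Ioi (0 : ℝ), Complex.exp (-(ξ : ℂ) / τ) * ∑' n : ℕ, GTerm ξ z n := by
    rw [laplace, ← integral_const_mul]
    congr 1 with ξ
    rw [G]
    ring
  have hkey : logPhi b ε (z / (2 * Real.pi * b)) =
      Li2 (-Complex.exp z) / (2 * Real.pi * Complex.I * τ) +
        laplace (fun ξ : ℝ => G ξ z) τ := by
    have hsplit : ∀ t : ℝ, kernel z (t + δ * Complex.I) *
        (Real.pi / (((t : ℂ) + δ * Complex.I) *
            Complex.sinh (Real.pi * (τ * ((t : ℂ) + δ * Complex.I)))) -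
          1 / (τ * ((t : ℂ) + δ * Complex.I) ^ 2)) =
        2 * Real.pi * (kernel z (t + δ * Complex.I) * (1 / (2 * (((t : ℂ) + δ * Complex.I) *
          Complex.sinh (Real.pi * (τ * ((t : ℂ) + δ * Complex.I))))))) -
        1 / τ * (kernel z (t + δ * Complex.I) * (1 / ((t : ℂ) + δ * Complex.I) ^ 2)) := by
      intro t
      simp only [mul_inv, div_eq_mul_inv]
      ring
    rw [hlaplace, integral_exp_mul_tsum_GTerm hτ hz h0 h1 h2]
    simp_rw [hsplit]
    rw [integral_sub (hkint.const_mul _) (hkint2.const_mul _), integral_const_mul,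
      integral_const_mul, integral_kernel_div_sq hz h0 h1, ← hlogPhi]
    field_simp
    linear_combination (-Li2 (-Complex.exp z)) * Complex.I_sq
  refine ⟨hFint, fun ξ _ => summable_GTerm hz ξ, integrableOn_exp_mul_G hτ hz, hkey, ?_⟩
  rw [Phi, hkey]
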